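/- Work in the effective topos, the realizability topos over Kleene's first algebra, and let $\Sigma$ be its object of semidecidable truth values, i.e. those $p$ for which there is $f \in 2^{\mathbb N}$ with $p \Leftrightarrow \exists n\, f(n)=1$. Let $(B_n)_{n\in\mathbb N}$ be a sequence of semidecidable subsets of an object $X$, i.e. of elements of $\Sigma^X$. It is a *pointwise base* if for all $i,j$ and all $x \in B_i\cap B_j$ there is $k$ with $x \in B_k \subseteq B_i \cap B_j$. It is a *countable base* if there is a $\sigma$-subframe $\mathcal T$ of $\Sigma^X$ (a subset closed under finite intersections and countable unions) such that every $B_n$ is in $\mathcal T$ and every $U\in\mathcal T$ is of the form $\bigcup_{i\in I}B_i$ for a countable $I\subseteq\mathbb N$, where $I$ is countable if there is a surjection $\mathbb N \to 1+I$. A *numbered set* is a set $X$ with a partial surjection $\nu : \mathbb N \rightharpoonup X$; it is regarded as an object of the effective topos in which $x$ is realized by the numbers $m$ with $\nu(m)=x$. A subset $S$ of a numbered set is regarded as the predicate in which $x\in S$ is realized by the numbers $m$ with $\nu(m)=x$. **Proposition.** (1) There are a numbered set $X$ and a sequence $(B_n)_{n\in\mathbb N}$ of subsets of $X$ such that the following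 holds in the effective topos: the sequence is a sequence of semidecidable subsets of $X$ that covers $X$ and is a pointwise base, but it is not a countable base. (2) Let $M\subseteq\mathbb N$ be a maximal c.e. set, i.e. $M$ is c.e., infinite and coinfinite, and for every c.e. set $K\supseteq M$ one of $K\setminus M$, $\mathbb N\setminus K$ is finite. Then there are sets $U,V,X\subseteq\mathbb N$ such that $$M\subseteq U\cap V,\qquad U\cup V\subseteq X,$$ none of $U\cap V$, $U$, $V$, $X$ is c.e., and the sets $U\setminus V$, $V\setminus U$, $X\setminus(U\cup V)$, $\mathbb N\setminus(U\cup V)$ and $\mathbb N\setminus X$ are infinite. For every such choice, number $X$ by letting $\nu(4n+2j+i)=n$, for $i,j\in\{0,1\}$, precisely when $n\in X$, $(i=1\Leftrightarrow n\in U)$ and $(j=1\Leftrightarrow n\in V)$, with $\nu$ undefined otherwise, and put $B_0=U$, $B_1=V$, $B_{n+2}=\{n\}\cap X$. Then $X$ and $(B_n)_{n\in\mathbb N}$ are as in (1). -/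

import Mathlib

/-! ### Kleene realizability: the truth values of the effective topos -/

namespace Eff

/-- Kleene application: the `e`-th partial computable function applied to `n`. -/
def app (e n : ℕ) : Part ℕ := (Denumerable.ofNat Nat.Partrec.Code e).eval n

/-- A truth value of the effective tripos: the set of its realizers. -/
abbrev RProp := Set ℕ

namespace RProp

def and (p q : RProp) : RProp := {r | r.unpair.1 ∈ p ∧ r.unpair.2 ∈ q}

def or (p q : RProp) : RProp :=
  {r | (r.unpair.1 = 0 ∧ r.unpair.2 ∈ p) ∨ (r.unpair.1 = 1 ∧ r.unpair.2 ∈ q)}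

def imp (p q : RProp) : RProp := {r | ∀ n ∈ p, ∃ m ∈ app r n, m ∈ q}

def neg (p : RProp) : RProp := imp p ∅

def iff (p q : RProp) : RProp := and (imp p q) (imp q p)

/-- A closed formula holds in the effective topos when it has a realizer. -/
def Valid (p : RProp) : Prop := Set.Nonempty p

end RProp

open RProp

/-- Every partial computable function has an index. -/
theorem exists_index {f : ℕ →. ℕ} (hf : Nat.Partrec f) : ∃ e, ∀ n, app e n = f n := by
  obtain ⟨c, hc⟩ := Nat.Partrec.Code.exists_code.1 hf
  exact ⟨Encodable.encode c, fun n => by simp [app, hc]⟩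

/-- A realizer of an implication, from a computable function. -/
theorem valid_imp {ι : Type*} {p q : ι → RProp} {f : ℕ → ℕ} (hf : Computable f)
    (h : ∀ i, ∀ n ∈ p i, f n ∈ q i) : Set.Nonempty (⋂ i, imp (p i) (q i)) := by
  obtain ⟨e, he⟩ := exists_index (Partrec.nat_iff.1 hf.partrec)
  refine ⟨e, Set.mem_iInter.2 fun i n hn => ⟨f n, ?_, h i n hn⟩⟩
  rw [he]
  simp

/-- Composition of indices. -/
def compIdx (a b : ℕ) : ℕ :=
  Encodable.encode ((Denumerable.ofNat Nat.Partrec.Code a).comp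
    (Denumerable.ofNat Nat.Partrec.Code b))

theorem computable_compIdx : Computable₂ compIdx :=
  (Computable.encode.comp (Nat.Partrec.Code.primrec₂_comp.comp
    ((Primrec.ofNat _).comp Primrec.fst) ((Primrec.ofNat _).comp Primrec.snd)).to_comp).to₂

theorem app_compIdx (a b n : ℕ) : app (compIdx a b) n = (app b n).bind (app a) := by
  simp only [app, compIdx, Denumerable.ofNat_encode]
  rfl

theorem imp_comp {p q r : RProp} {a b : ℕ} (ha : a ∈ imp q r) (hb : b ∈ imp p q) :
    compIdx a b ∈ imp p r := by
  intro n hn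
  obtain ⟨m, hm, hmq⟩ := hb n hn
  obtain ⟨k, hk, hkr⟩ := ha m hmq
  exact ⟨k, by rw [app_compIdx]; exact Part.mem_bind hm hk, hkr⟩

/-- The index of `n ↦ ⟨a n, b n⟩`. -/
def pairIdx (a b : ℕ) : ℕ :=
  Encodable.encode ((Denumerable.ofNat Nat.Partrec.Code a).pair
    (Denumerable.ofNat Nat.Partrec.Code b))

theorem computable_pairIdx : Computable₂ pairIdx :=
  (Computable.encode.comp (Nat.Partrec.Code.primrec₂_pair.comp
    ((Primrec.ofNat _).comp Primrec.fst) ((Primrec.ofNat _).comp Primrec.snd)).to_comp).to₂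

theorem imp_pair {p q r : RProp} {a b : ℕ} (ha : a ∈ imp p q) (hb : b ∈ imp p r) :
    pairIdx a b ∈ imp p (and q r) := by
  intro n hn
  obtain ⟨m, hm, hmq⟩ := ha n hn
  obtain ⟨k, hk, hkr⟩ := hb n hn
  refine ⟨Nat.pair m k, ?_, by simpa [RProp.and] using ⟨hmq, hkr⟩⟩
  simp only [app] at hm hk
  simp only [app, pairIdx, Denumerable.ofNat_encode, Nat.Partrec.Code.eval]
  rw [Part.eq_some_iff.2 hm, Part.eq_some_iff.2 hk]
  simp [Seq.seq]

theorem computable_fst : Computable fun n : ℕ => n.unpair.1 :=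
  (Primrec.fst.comp Primrec.unpair).to_comp

theorem computable_snd : Computable fun n : ℕ => n.unpair.2 :=
  (Primrec.snd.comp Primrec.unpair).to_comp

theorem computable_mk {f g : ℕ → ℕ} (hf : Computable f) (hg : Computable g) :
    Computable fun n => Nat.pair (f n) (g n) :=
  Primrec₂.natPair.to_comp.comp hf hg

/-! ### Objects of the effective topos -/

/-- An object of the effective topos: a set with a realizability-valued partial equivalence
relation. `eq x x` is the existence predicate of `x`. -/
structure Obj where
  Carrier : Type
  eq : Carrier → Carrier → RProp
  symm : Set.Nonempty (⋂ i : Carrier × Carrier, imp (eq i.1 i.2) (eq i.2 i.1))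
  trans : Set.Nonempty (⋂ i : Carrier × Carrier × Carrier,
    imp (and (eq i.1 i.2.1) (eq i.2.1 i.2.2)) (eq i.1 i.2.2))

/-- The internal quantifier `∀ x ∈ X, φ x`. -/
def all (X : Obj) (φ : X.Carrier → RProp) : RProp := ⋂ x, imp (X.eq x x) (φ x)

/-- The internal quantifier `∃ x ∈ X, φ x`. -/
def ex (X : Obj) (φ : X.Carrier → RProp) : RProp := ⋃ x, and (X.eq x x) (φ x)

/-- The object in which `x` is realized by the elements of `E x`, with actual equality. -/
def assembly (α : Type) (E : α → Set ℕ) : Obj where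
  Carrier := α
  eq x y := {n | n ∈ E x ∧ x = y}
  symm := valid_imp (f := fun n => n) Computable.id
    (by
      rintro ⟨x, y⟩ n ⟨h, h1⟩
      obtain rfl : x = y := h1
      exact ⟨h, rfl⟩)
  trans := valid_imp computable_fst (by
    rintro ⟨x, y, z⟩ n ⟨⟨h, h1⟩, -, h2⟩
    exact ⟨h, h1.trans h2⟩)

/-- A countable discrete object, every element being realized by its code only. -/
def disc (α : Type) [Encodable α] : Obj := assembly α fun a => {Encodable.encode a}

/-- The natural numbers object, `n` being realized by `n`. -/
def nat : Obj := disc ℕ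

/-- `A` is a strict, extensional predicate on `X`. -/
def isPred (X : Obj) (A : X.Carrier → RProp) : RProp :=
  and (⋂ x, imp (A x) (X.eq x x))
    (⋂ i : X.Carrier × X.Carrier, imp (and (A i.1) (X.eq i.1 i.2)) (A i.2))

/-- The power object `Ω^X`: its elements are the strict, extensional predicates on `X`, and
equality is logical equivalence. -/
def power (X : Obj) : Obj where
  Carrier := X.Carrier → RProp
  eq A B := and (and (isPred X A) (isPred X B))
    (and (⋂ x, imp (A x) (B x)) (⋂ x, imp (B x) (A x)))
  symm := valid_imp
    (computable_mk
      (computable_mk (computable_snd.comp computable_fst) (computable_fst.comp computable_fst))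
      (computable_mk (computable_snd.comp computable_snd) (computable_fst.comp computable_snd)))
    (by
      rintro ⟨A, B⟩ n ⟨⟨h1, h2⟩, h3, h4⟩
      simp only [RProp.and, Set.mem_ofPred_eq, Nat.unpair_pair]
      exact ⟨⟨h2, h1⟩, h4, h3⟩)
  trans := valid_imp
    (computable_mk
      (computable_mk (computable_fst.comp (computable_fst.comp computable_fst))
        (computable_snd.comp (computable_fst.comp computable_snd)))
      (computable_mk
        (computable_compIdx.comp (computable_fst.comp (computable_snd.comp computable_snd))
          (computable_fst.comp (computable_snd.comp computable_fst)))
        (computable_compIdx.comp (computable_snd.comp (computable_snd.comp computable_fst))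
          (computable_snd.comp (computable_snd.comp computable_snd)))))
    (by
      rintro ⟨A, B, C⟩ n ⟨⟨⟨h1, -⟩, h3, h4⟩, ⟨-, h6⟩, h7, h8⟩
      simp only [RProp.and, Set.mem_ofPred_eq, Nat.unpair_pair]
      simp only [Set.mem_iInter] at h3 h4 h7 h8
      refine ⟨⟨h1, h6⟩, ?_, ?_⟩
      · exact Set.mem_iInter.2 fun x => imp_comp (h7 x) (h3 x)
      · exact Set.mem_iInter.2 fun x => imp_comp (h4 x) (h8 x))

/-- The subobject `{x ∈ X | φ x}` given by an (extensional) predicate `φ`. -/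
def sub (X : Obj) (φ : X.Carrier → RProp) : Obj where
  Carrier := X.Carrier
  eq x y := and (X.eq x y) (and (φ x) (φ y))
  symm := by
    obtain ⟨s, hs⟩ := X.symm
    obtain ⟨e, he⟩ := exists_index (f := fun n => (app s n.unpair.1).map fun m =>
        Nat.pair m (Nat.pair n.unpair.2.unpair.2 n.unpair.2.unpair.1))
      (Partrec.nat_iff.1 (Partrec.map
        (Nat.Partrec.Code.eval_part.comp (Computable.const (Denumerable.ofNat _ s)) computable_fst)
        (Primrec₂.natPair.to_comp.comp Computable.snd
          ((computable_mk (computable_snd.comp computable_snd)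
            (computable_fst.comp computable_snd)).comp Computable.fst)).to₂))
    refine ⟨e, Set.mem_iInter.2 ?_⟩
    rintro ⟨x, y⟩ n ⟨h1, h2, h3⟩
    obtain ⟨m, hm, hm'⟩ := Set.mem_iInter.1 hs (x, y) _ h1
    refine ⟨_, by rw [he]; exact Part.mem_map _ hm, ?_⟩
    simp only [RProp.and, Set.mem_ofPred_eq, Nat.unpair_pair]
    exact ⟨hm', h3, h2⟩
  trans := by
    obtain ⟨s, hs⟩ := X.trans
    obtain ⟨e, he⟩ := exists_index (f := fun n =>
        (app s (Nat.pair n.unpair.1.unpair.1 n.unpair.2.unpair.1)).map fun m =>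
        Nat.pair m (Nat.pair n.unpair.1.unpair.2.unpair.1 n.unpair.2.unpair.2.unpair.2))
      (Partrec.nat_iff.1 (Partrec.map
        (Nat.Partrec.Code.eval_part.comp (Computable.const (Denumerable.ofNat _ s))
          (computable_mk (computable_fst.comp computable_fst)
            (computable_fst.comp computable_snd)))
        (Primrec₂.natPair.to_comp.comp Computable.snd
          ((computable_mk (computable_fst.comp (computable_snd.comp computable_fst))
            (computable_snd.comp (computable_snd.comp computable_snd))).comp
              Computable.fst)).to₂))
    refine ⟨e, Set.mem_iInter.2 ?_⟩
    rintro ⟨x, y, z⟩ n ⟨⟨h1, h2, -⟩, h4, -, h6⟩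
    obtain ⟨m, hm, hm'⟩ := Set.mem_iInter.1 hs (x, y, z)
      (Nat.pair n.unpair.1.unpair.1 n.unpair.2.unpair.1)
      (by simpa [RProp.and] using ⟨h1, h4⟩)
    refine ⟨_, by rw [he]; exact Part.mem_map _ hm, ?_⟩
    simp only [RProp.and, Set.mem_ofPred_eq, Nat.unpair_pair]
    exact ⟨hm', h2, h6⟩

/-- The exponential `X^ℕ`. As every natural number has exactly one realizer, each functional
relation from `ℕ` to `X` is given by a function of the carriers that is tracked by an index. -/
def seq (X : Obj) : Obj where
  Carrier := ℕ → X.Carrier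
  eq f g := ⋂ n, imp (nat.eq n n) (X.eq (f n) (g n))
  symm := by
    obtain ⟨s, hs⟩ := X.symm
    refine valid_imp (computable_compIdx.comp (Computable.const s) Computable.id) ?_
    rintro ⟨f, g⟩ n hn
    exact Set.mem_iInter.2 fun k =>
      imp_comp (Set.mem_iInter.1 hs (f k, g k)) (Set.mem_iInter.1 hn k)
  trans := by
    obtain ⟨s, hs⟩ := X.trans
    refine valid_imp (computable_compIdx.comp (Computable.const s)
      (computable_pairIdx.comp computable_fst computable_snd)) ?_
    rintro ⟨f, g, h⟩ n ⟨h1, h2⟩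
    exact Set.mem_iInter.2 fun k =>
      imp_comp (Set.mem_iInter.1 hs (f k, g k, h k))
        (imp_pair (Set.mem_iInter.1 h1 k) (Set.mem_iInter.1 h2 k))

/-! ### Synthetic topology in the internal language -/

/-- `p ∈ Σ`: there is `f ∈ 2^ℕ` such that `p ⇔ ∃ n ∈ ℕ, f n = 1`. -/
def semidecidable (p : RProp) : RProp :=
  ex (seq (disc Bool)) fun f => iff p (ex nat fun n => (disc Bool).eq (f n) true)

/-- The intrinsic topology `Σ^X`, as a subobject of `Ω^X`. -/
def opens (X : Obj) : Obj := sub (power X) fun A => all X fun x => semidecidable (A x)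

/-- The subset `I` of `ℕ` is countable: there is a surjection `e` from `ℕ` to `1 + I`
(`none` is the element of `1`). -/
def countable (I : nat.Carrier → RProp) : RProp :=
  ex (seq (disc (Option ℕ))) fun e =>
    and
      (all nat fun m => or ((disc (Option ℕ)).eq (e m) none)
        (ex nat fun n => and (I n) ((disc (Option ℕ)).eq (e m) (some n))))
      (and
        (ex nat fun m => (disc (Option ℕ)).eq (e m) none)
        (all nat fun n => imp (I n) (ex nat fun m => (disc (Option ℕ)).eq (e m) (some n))))

/-- `T ⊆ Σ^X` is a Malcev topology, that is, a `σ`-subframe of `Σ^X`: it contains `X` and is closed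
under binary intersections, contains the empty set and is closed under unions of sequences. -/
def malcevTopology (X : Obj) (T : (opens X).Carrier → RProp) : RProp :=
  and
    (and (T fun x => X.eq x x)
      (all (opens X) fun U => all (opens X) fun V =>
        imp (and (T U) (T V)) (T fun x => and (U x) (V x))))
    (and (T fun _ => ∅)
      (all (seq (opens X)) fun F =>
        imp (all nat fun n => T (F n)) (T fun x => ex nat fun n => F n x)))

/-- `B` is a countable base for the `σ`-frame `T ⊆ Σ^X`: its members belong to `T`, and every `U ∈ T`
is the union of the `B i`, `i ∈ I`, for a countable `I ⊆ ℕ`. -/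
def countableBaseFor (X : Obj) (T : (opens X).Carrier → RProp)
    (B : (seq (opens X)).Carrier) : RProp :=
  and (all nat fun n => T (B n))
    (all (opens X) fun U => imp (T U)
      (ex (power nat) fun I => and (countable I)
        (all X fun x => iff (U x) (ex nat fun i => and (I i) (B i x)))))

/-- `B` is a countable base: it is a countable base for some Malcev topology on `X`. -/
def countableBase (X : Obj) (B : (seq (opens X)).Carrier) : RProp :=
  ex (power (opens X)) fun T => and (malcevTopology X T) (countableBaseFor X T B)

/-- `U ⊆ X` is pointwise open with respect to `B`. -/
def pointwiseOpen (X : Obj) (B : (seq (opens X)).Carrier) (U : X.Carrier → RProp) : RProp :=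
  all X fun x => imp (U x)
    (ex nat fun i => and (B i x) (all X fun y => imp (B i y) (U y)))

/-- `B` is a pointwise base: all `B i ∩ B j` are pointwise open. -/
def pointwiseBase (X : Obj) (B : (seq (opens X)).Carrier) : RProp :=
  all nat fun i => all nat fun j => pointwiseOpen X B fun x => and (B i x) (B j x)

/-- `B` covers `X`. -/
def covers (X : Obj) (B : (seq (opens X)).Carrier) : RProp :=
  all X fun x => ex nat fun i => B i x

/-- In the effective topos, `B` is a sequence of semidecidable subsets of `X` that covers `X` and is
a pointwise base, but not a countable base. -/
def IsPointwiseNotCountableBase (X : Obj) (B : (seq (opens X)).Carrier) : Prop :=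
  Valid ((seq (opens X)).eq B B) ∧ Valid (covers X B) ∧ Valid (pointwiseBase X B) ∧
    Valid (neg (countableBase X B))

/-! ### Numbered sets -/

/-- A numbered set: a set with a partial surjection from `ℕ`. -/
structure NumberedSet where
  Carrier : Type
  ν : ℕ →. Carrier
  surj : ∀ x, ∃ n, x ∈ ν n

/-- A numbered set as an object of the effective topos: `x` is realized by its `ν`-indices. -/
def NumberedSet.toObj (X : NumberedSet) : Obj := assembly X.Carrier fun x => {n | x ∈ X.ν n}

/-- A sequence of subsets of a numbered set, as a sequence of predicates in the effective topos:
`x ∈ S n` is realized by the `ν`-indices of `x`. -/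
def NumberedSet.family (X : NumberedSet) (S : ℕ → Set X.Carrier) :
    (seq (opens X.toObj)).Carrier :=
  fun n (x : X.Carrier) => {m | x ∈ X.ν m ∧ x ∈ S n}

/-- A maximal computably enumerable set. -/
structure IsMaximalCE (M : Set ℕ) : Prop where
  ce : REPred (· ∈ M)
  infinite : M.Infinite
  coinfinite : Mᶜ.Infinite
  maximal : ∀ K : Set ℕ, REPred (· ∈ K) → M ⊆ K → (K \ M).Finite ∨ Kᶜ.Finite

/-- The sets `U`, `V`, `X` are chosen over the maximal c.e. set `M`. -/
structure IsConfiguration (M U V X : Set ℕ) : Prop where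
  subset_inter : M ⊆ U ∩ V
  inter_not_ce : ¬ REPred (· ∈ U ∩ V)
  left_not_ce : ¬ REPred (· ∈ U)
  right_not_ce : ¬ REPred (· ∈ V)
  left_diff : (U \ (U ∩ V)).Infinite
  right_diff : (V \ (U ∩ V)).Infinite
  union_coinfinite : (U ∪ V)ᶜ.Infinite
  union_subset : U ∪ V ⊆ X
  not_ce : ¬ REPred (· ∈ X)
  coinfinite : Xᶜ.Infinite
  diff : (X \ (U ∪ V)).Infinite

/-- The numbering of `X` in which `4 * n + 2 * j + i`, for `i, j ∈ {0, 1}`, is an index of `n ∈ X`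
precisely when `i = 1 ↔ n ∈ U` and `j = 1 ↔ n ∈ V`. -/
def bitNumbering (U V X : Set ℕ) : NumberedSet where
  Carrier := X
  ν m := ⟨m / 4 ∈ X ∧ (m % 2 = 1 ↔ m / 4 ∈ U) ∧ (m / 2 % 2 = 1 ↔ m / 4 ∈ V),
    fun h => ⟨m / 4, h.1⟩⟩
  surj := by
    classical
    rintro ⟨n, hn⟩
    have key : ∀ i j : ℕ, i < 2 → j < 2 → (4 * n + 2 * j + i) / 4 = n ∧
        (4 * n + 2 * j + i) % 2 = i ∧ (4 * n + 2 * j + i) / 2 % 2 = j := by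
      intro i j hi hj
      omega
    obtain ⟨h1, h2, h3⟩ := key (if n ∈ U then 1 else 0) (if n ∈ V then 1 else 0)
      (by split_ifs <;> simp) (by split_ifs <;> simp)
    refine ⟨4 * n + 2 * (if n ∈ V then 1 else 0) + (if n ∈ U then 1 else 0), ?_⟩
    refine Part.mem_mk_iff.2 ⟨⟨by rw [h1]; exact hn, ?_, ?_⟩, Subtype.ext h1⟩
    · rw [h1, h2]; split_ifs <;> simp_all
    · rw [h1, h3]; split_ifs <;> simp_all

/-- The sequence `U, V, {0} ∩ X, {1} ∩ X, {2} ∩ X, …` of subsets of `X`. -/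
def bitSets (U V X : Set ℕ) : ℕ → Set (bitNumbering U V X).Carrier
  | 0 => {x : X | (x : ℕ) ∈ U}
  | 1 => {x : X | (x : ℕ) ∈ V}
  | n + 2 => {x : X | (x : ℕ) = n}

end Eff

namespace Eff

open RProp

/-! ### Computably enumerable sets -/

/-! The bits of an index of `n` decide membership in `U` and `V`, and the index yields `n` itself.
So the sequence is semidecidable and covers, and the singletons, found computably, make it a
pointwise base.

A countable base fails because it would enumerate `U ∩ V`. If the sequence were a countable base for
some `T`, then `U ∩ V` would lie in `T` and hence be the union of the `B k`, `k ∈ I`, with `I`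
internally countable, therefore c.e. (`exists_rePred_of_countableBase`). As neither of `U`, `V`
contains the other, `0` and `1` are not in `I`. Only singletons remain, so `U ∩ V` is the trace on
`X` of a c.e. set `K` (`isPointwiseNotCountableBase_bitNumbering`).

Over a maximal set `M` no such `K` exists: `M ⊆ K`, so either `K \ M` is finite and `U ∩ V` is c.e.,
or `K` is cofinite and `U \ V` is finite. Since a negation is realized as soon as the negated
formula has no realizer, this refutation can be carried out externally, without tracking realizers.
-/

theorem _root_.REPred.insert {p : ℕ → Prop} (hp : REPred p) (a : ℕ) :
    REPred fun n => n = a ∨ p n := by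
  have h1 : Computable fun n : ℕ => decide (n = a) :=
    (Primrec.eq.decide.comp Primrec.id (Primrec.const a)).to_comp
  refine (Partrec.cond h1 (Computable.const ()).partrec hp).of_eq fun n => ?_
  by_cases h : n = a
  · subst h
    simp only [decide_true, cond_true, true_or, Part.assert_pos]
    rfl
  · have h' : (n = a ∨ p n) = p n := by simp [h]
    rw [decide_eq_false h]
    exact congrArg (fun q => Part.assert q fun _ => Part.some ()) h'.symm

theorem _root_.REPred.union_finite {A : Set ℕ} (hA : REPred (· ∈ A)) {F : Set ℕ}
    (hF : F.Finite) : REPred (· ∈ A ∪ F) := by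
  induction F, hF using Set.Finite.induction_on with
  | empty => simpa using hA
  | @insert a s _ _ ih =>
    refine (ih.insert a).of_eq fun n => ?_
    simp only [Set.mem_union, Set.mem_insert_iff]
    tauto

theorem _root_.REPred.comp_computable {α β : Type*} [Primcodable α] [Primcodable β]
    {p : β → Prop} (hp : REPred p) {f : α → β} (hf : Computable f) : REPred fun a => p (f a) :=
  Partrec.comp hp hf

theorem rePred_exists_eq {α : Type*} [Primcodable α] [DecidableEq α] {e : ℕ → α}
    (he : Computable e) : REPred fun a => ∃ m, e m = a := by
  have h : Computable fun q : α × ℕ => decide (e q.2 = q.1) :=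
    Primrec.eq.decide.to_comp.comp (he.comp Computable.snd) Computable.fst
  refine (Partrec.rfind (p := fun a m => Part.some (decide (e m = a))) h.partrec).dom_re.of_eq
    fun a => Nat.rfind_dom.trans ?_
  simp [eq_comm]

theorem exists_not_rePred : ∃ A : Set ℕ, ¬ REPred (· ∈ A) := by
  refine ⟨{n | ¬ ((Denumerable.ofNat Nat.Partrec.Code n).eval 0).Dom}, fun h => ?_⟩
  refine ComputablePred.halting_problem_not_re 0
    ((h.comp_computable Computable.encode).of_eq fun c => ?_)
  simp

/-- A set lying infinitely far above and below a maximal c.e. set is not c.e. -/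
theorem IsMaximalCE.not_rePred {M : Set ℕ} (hM : IsMaximalCE M) {K : Set ℕ} (hMK : M ⊆ K)
    (h1 : (K \ M).Infinite) (h2 : Kᶜ.Infinite) : ¬ REPred (· ∈ K) := fun h =>
  (hM.maximal K h hMK).elim h1 h2

/-- Split the complement of `M` into five infinite classes, by the residue mod 5 of a (not
necessarily computable) injective enumeration `g`. Adjoining some but not all classes to `M` gives a
set that maximality prevents from being c.e. -/
theorem IsMaximalCE.exists_isConfiguration {M : Set ℕ} (hM : IsMaximalCE M) :
    ∃ U V X : Set ℕ, IsConfiguration M U V X := by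
  let g := hM.coinfinite.natEmbedding
  have hg : ∀ n, (g n : ℕ) ∉ M := fun n => (g n).2
  have inj : Function.Injective fun n => (g n : ℕ) := Subtype.val_injective.comp g.injective
  let P : ℕ → Set ℕ := fun k => (fun n => (g n : ℕ)) '' {n | n % 5 = k}
  let A : Set ℕ → Set ℕ := fun s => M ∪ ⋃ k ∈ s, P k
  have hP : ∀ k < 5, (P k).Infinite := fun k hk => by
    refine Set.Infinite.image inj.injOn (Set.infinite_of_injective_forall_mem
      (f := fun n => 5 * n + k) (fun a b h => by simpa using h) fun n => ?_)
    simp only [Set.mem_ofPred_eq]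
    omega
  have memA : ∀ s n, (g n : ℕ) ∈ A s ↔ n % 5 ∈ s := by
    intro s n
    constructor
    · rintro (h | h)
      · exact absurd h (hg n)
      · simp only [Set.mem_iUnion] at h
        obtain ⟨k, hk, m, rfl, hm⟩ := h
        rwa [← inj hm]
    · exact fun h => Or.inr (Set.mem_biUnion h ⟨n, rfl, rfl⟩)
  have compl : ∀ s, ∀ k < 5, k ∉ s → (A s)ᶜ.Infinite := fun s k hk hs =>
    (hP k hk).mono (by
      rintro _ ⟨n, rfl, rfl⟩ h
      exact hs ((memA s n).1 h))
  have diff : ∀ s t, ∀ k < 5, k ∈ s → k ∉ t → (A s \ A t).Infinite := fun s t k hk hs ht =>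
    (hP k hk).mono (by
      rintro _ ⟨n, rfl, rfl⟩
      exact ⟨(memA s n).2 hs, fun h => ht ((memA t n).1 h)⟩)
  have mono : ∀ s t, s ⊆ t → A s ⊆ A t := fun s t h =>
    Set.union_subset_union_right _ (Set.biUnion_subset_biUnion_left h)
  have empty : A ∅ = M := by simp [A]
  have sub : ∀ s, M ⊆ A s := fun s => Set.subset_union_left
  have inter : ∀ s t, A s ∩ A t = A (s ∩ t) := fun s t => by
    refine Set.Subset.antisymm ?_ (Set.subset_inter (mono _ _ Set.inter_subset_left)
      (mono _ _ Set.inter_subset_right))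
    rintro x ⟨hs | hs, ht⟩
    · exact Or.inl hs
    · simp only [Set.mem_iUnion] at hs
      obtain ⟨k, hk, m, rfl, rfl⟩ := hs
      exact (memA _ _).2 ⟨hk, (memA _ _).1 ht⟩
  have union : ∀ s t, A s ∪ A t = A (s ∪ t) := fun s t => by
    simp only [A, Set.biUnion_union]
    exact (Set.union_union_distrib_left _ _ _).symm
  have not_ce : ∀ s, ∀ k < 5, ∀ l < 5, k ∈ s → l ∉ s → ¬ REPred (· ∈ A s) :=
    fun s k hk l hl hks hls =>
      hM.not_rePred (sub s) (empty ▸ diff s ∅ k hk hks (by simp)) (compl s l hl hls)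
  -- Class 0 goes to `U ∩ V`, 1 to `U` only, 2 to `V` only, 3 to `X` outside `U ∪ V`, and 4 stays
  -- outside `X`.
  refine ⟨A {0, 1}, A {0, 2}, A {0, 1, 2, 3}, ?_⟩
  constructor
  · exact Set.subset_inter (sub _) (sub _)
  · rw [inter]
    exact not_ce _ 0 (by simp) 4 (by simp) (by simp) (by simp)
  · exact not_ce _ 0 (by simp) 4 (by simp) (by simp) (by simp)
  · exact not_ce _ 0 (by simp) 4 (by simp) (by simp) (by simp)
  · rw [inter]
    exact diff _ _ 1 (by simp) (by simp) (by simp)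
  · rw [inter]
    exact diff _ _ 2 (by simp) (by simp) (by simp)
  · rw [union]
    exact compl _ 4 (by simp) (by simp)
  · rw [union]
    exact mono _ _ (by intro; simp; omega)
  · exact not_ce _ 0 (by simp) 4 (by simp) (by simp) (by simp)
  · exact compl _ 4 (by simp) (by simp)
  · rw [union]
    exact diff _ _ 3 (by simp) (by simp) (by simp)

/-! ### Indices and realizers -/

/-- The index of a constant function. -/
def constIdx (k : ℕ) : ℕ := Encodable.encode (Nat.Partrec.Code.const k)

theorem computable_constIdx : Computable constIdx :=
  Computable.encode.comp Nat.Partrec.Code.primrec_const.to_comp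

theorem constIdx_mem_imp {p q : RProp} {k : ℕ} (h : k ∈ q) : constIdx k ∈ imp p q :=
  fun n _ => ⟨k, by simp [app, constIdx], h⟩

/-- The parametrization theorem, for total functions. -/
theorem exists_parametrization {g : ℕ → ℕ} (hg : Computable g) :
    ∃ h : ℕ → ℕ, Computable h ∧ ∀ n m, app (h n) m = Part.some (g (Nat.pair n m)) := by
  obtain ⟨c, hc⟩ := Nat.Partrec.Code.exists_code.1 (Partrec.nat_iff.1 hg.partrec)
  refine ⟨fun n => Encodable.encode (c.curry n), Computable.encode.comp
    (Nat.Partrec.Code.primrec₂_curry.comp (Primrec.const c) Primrec.id).to_comp, fun n m => ?_⟩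
  simp [app, Nat.Partrec.Code.eval_curry, hc]

theorem exists_index_total {f : ℕ → ℕ} (hf : Computable f) : ∃ e, ∀ n, f n ∈ app e n := by
  obtain ⟨e, he⟩ := exists_index (Partrec.nat_iff.1 hf.partrec)
  exact ⟨e, fun n => by simp [he]⟩

namespace RProp

theorem pair_mem_and {p q : RProp} {a b : ℕ} :
    Nat.pair a b ∈ and p q ↔ a ∈ p ∧ b ∈ q := by
  simp [RProp.and]

theorem Valid.mp {p q : RProp} (h : Valid (imp p q)) (hp : Valid p) : Valid q := by
  obtain ⟨r, hr⟩ := h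
  obtain ⟨n, hn⟩ := hp
  obtain ⟨m, -, hm⟩ := hr n hn
  exact ⟨m, hm⟩

theorem valid_and {p q : RProp} : Valid (and p q) ↔ Valid p ∧ Valid q :=
  ⟨fun ⟨_, h1, h2⟩ => ⟨⟨_, h1⟩, ⟨_, h2⟩⟩,
    fun ⟨⟨a, ha⟩, ⟨b, hb⟩⟩ => ⟨Nat.pair a b, pair_mem_and.2 ⟨ha, hb⟩⟩⟩

theorem valid_or {p q : RProp} (h : Valid (or p q)) : Valid p ∨ Valid q := by
  obtain ⟨_, ⟨-, h⟩ | ⟨-, h⟩⟩ := h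
  exacts [Or.inl ⟨_, h⟩, Or.inr ⟨_, h⟩]

theorem valid_neg {p : RProp} (h : ¬ Valid p) : Valid (neg p) :=
  ⟨0, fun n hn => absurd ⟨n, hn⟩ h⟩

theorem valid_iInter {ι : Type*} {p : ι → RProp} (h : Valid (⋂ i, p i)) (i : ι) : Valid (p i) :=
  h.mono (Set.iInter_subset p i)

theorem valid_all {X : Obj} {φ : X.Carrier → RProp} (h : Valid (all X φ)) {x : X.Carrier}
    (hx : Valid (X.eq x x)) : Valid (φ x) :=
  Valid.mp (valid_iInter h x) hx

theorem valid_ex {X : Obj} {φ : X.Carrier → RProp} :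
    Valid (ex X φ) ↔ ∃ x, Valid (X.eq x x) ∧ Valid (φ x) := by
  simp only [ex, ← valid_and]
  exact Set.nonempty_iUnion

end RProp

theorem mem_disc_eq {α : Type} [Encodable α] {a b : α} {n : ℕ} :
    n ∈ (disc α).eq a b ↔ n = Encodable.encode a ∧ a = b := Iff.rfl

theorem valid_disc_eq {α : Type} [Encodable α] {a b : α} : Valid ((disc α).eq a b) ↔ a = b :=
  ⟨fun ⟨_, _, h⟩ => h, fun h => ⟨_, rfl, h⟩⟩

theorem mem_nat_eq {n k : ℕ} : n ∈ nat.eq k k ↔ n = k := by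
  simp [nat, mem_disc_eq]

theorem valid_nat_eq (n : ℕ) : Valid (nat.eq n n) := ⟨n, mem_nat_eq.2 rfl⟩

/-- Each element of a discrete object has its code as only realizer, so an index tracking `e` must
compute the code of `e n`. -/
theorem computable_of_valid_seq_disc {α : Type} [Primcodable α] {e : ℕ → α}
    (h : Valid ((seq (disc α)).eq e e)) : Computable e := by
  obtain ⟨r, hr⟩ := h
  have h1 : Partrec (app r) :=
    Nat.Partrec.Code.eval_part.comp (Computable.const (Denumerable.ofNat _ r)) Computable.id
  refine Computable.encode_iff.1 (h1.of_eq fun n => ?_)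
  obtain ⟨m, hm, hm', -⟩ := Set.mem_iInter.1 hr n n (mem_nat_eq.2 rfl)
  obtain rfl : m = Encodable.encode (e n) := hm'
  exact Part.eq_some_iff.2 hm

/-- A countable subset of `ℕ` in the effective topos is c.e. -/
theorem rePred_of_valid_countable {I : nat.Carrier → RProp} (h : Valid (countable I)) :
    REPred fun n : ℕ => Valid (I n) := by
  obtain ⟨e, he, h⟩ := valid_ex.1 h
  obtain ⟨h1, h⟩ := valid_and.1 h
  obtain ⟨-, h2⟩ := valid_and.1 h
  have hc : Computable (α := ℕ) (σ := Option ℕ) e := computable_of_valid_seq_disc he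
  refine ((rePred_exists_eq hc).comp_computable (f := fun n : ℕ => some n)
    Computable.option_some).of_eq fun n => ?_
  constructor
  · rintro ⟨m, hm⟩
    obtain h | h := valid_or (valid_all h1 (valid_nat_eq m))
    · cases hm.symm.trans (valid_disc_eq.1 h)
    · obtain ⟨k, -, h⟩ := valid_ex.1 h
      obtain ⟨h, h'⟩ := valid_and.1 h
      cases hm.symm.trans (valid_disc_eq.1 h')
      exact h
  · intro hn
    obtain ⟨m, -, h⟩ := valid_ex.1 ((valid_all h2 (valid_nat_eq n)).mp hn)
    exact ⟨m, valid_disc_eq.1 h⟩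

/-- If two members of a countable base are given, then their intersection is the union of a c.e.
subfamily. -/
theorem exists_rePred_of_countableBase {X : Obj} {B : (seq (opens X)).Carrier}
    (hB : Valid ((seq (opens X)).eq B B)) (h : Valid (countableBase X B)) (i j : ℕ) :
    ∃ I : Set ℕ, REPred (· ∈ I) ∧ ∀ x, Valid (X.eq x x) →
      ((Valid (B i x) ∧ Valid (B j x)) ↔ ∃ k ∈ I, Valid (B k x)) := by
  obtain ⟨T, hT, h⟩ := valid_ex.1 h
  obtain ⟨h1, h2⟩ := valid_and.1 h
  obtain ⟨h3, h4⟩ := valid_and.1 h2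
  have hBn : ∀ n : ℕ, Valid ((opens X).eq (B n) (B n)) := fun n =>
    (valid_iInter hB n).mp (valid_nat_eq n)
  have hTn : ∀ n : ℕ, Valid (T (B n)) := fun n => valid_all h3 (valid_nat_eq n)
  have hint := (valid_all (valid_all (valid_and.1 (valid_and.1 h1).1).2 (hBn i)) (hBn j)).mp
    (valid_and.2 ⟨hTn i, hTn j⟩)
  -- `T` is strict as an element of the power object, so the intersection is itself an element of
  -- `opens X`; this is needed to instantiate the quantifier in `h4`.
  have strict := (valid_and.1 (valid_and.1 (valid_and.1 hT).1).1).1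
  obtain ⟨I, -, h5⟩ := valid_ex.1 ((valid_all h4 ((valid_iInter strict _).mp hint)).mp hint)
  obtain ⟨h6, h7⟩ := valid_and.1 h5
  refine ⟨{n | Valid (I n)}, rePred_of_valid_countable h6, fun x hx => ?_⟩
  obtain ⟨h8, h9⟩ := valid_and.1 (valid_all h7 hx)
  constructor
  · rintro hx
    obtain ⟨k, -, h⟩ := valid_ex.1 (h8.mp (valid_and.2 hx))
    exact ⟨k, valid_and.1 h⟩
  · rintro ⟨k, hk⟩
    exact valid_and.1 (h9.mp (valid_ex.2 ⟨k, valid_nat_eq k, valid_and.2 hk⟩))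

/-! ### Families of subsets of a numbered set -/

namespace NumberedSet

variable (X : NumberedSet) (S : ℕ → Set X.Carrier)

theorem valid_eq (x : X.Carrier) : Valid (X.toObj.eq x x) :=
  (X.surj x).imp fun _ h => ⟨h, rfl⟩

theorem valid_family {n : ℕ} {x : X.Carrier} : Valid (X.family S n x) ↔ x ∈ S n :=
  ⟨fun ⟨_, _, h⟩ => h, fun h => (X.surj x).imp fun _ hm => ⟨hm, h⟩⟩

/-- A realizer of `x ∈ S n` is just an index of `x`, so the identity and the first projection work
uniformly in `n`. -/
theorem exists_mem_isPred_family :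
    ∃ r, ∀ n, r ∈ isPred X.toObj (X.family S n) := by
  obtain ⟨a, ha⟩ := exists_index_total Computable.id
  obtain ⟨b, hb⟩ := exists_index_total computable_fst
  refine ⟨Nat.pair a b, fun n => pair_mem_and.2 ⟨Set.mem_iInter.2 fun x m hm =>
    ⟨_, ha m, hm.1, rfl⟩, Set.mem_iInter.2 ?_⟩⟩
  rintro ⟨x, y⟩ m ⟨hm, -, h⟩
  obtain rfl : x = y := h
  exact ⟨_, hb m, hm⟩

/-- A family of subsets is a family of semidecidable subsets when membership in it is decided by a
computable function of the indices. -/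
theorem valid_seq_opens_eq {d : ℕ → Bool} (hd : Computable d)
    (h : ∀ n m x, x ∈ X.ν m → (d (Nat.pair n m) = true ↔ x ∈ S n)) :
    Valid ((seq (opens X.toObj)).eq (X.family S) (X.family S)) := by
  obtain ⟨p, hp⟩ := X.exists_mem_isPred_family S
  obtain ⟨a, ha⟩ := exists_index_total Computable.id
  -- For `q = ⟨n, m⟩` the truth value is witnessed by the constant sequence `d q`. Forwards, `⟨0,
  -- 1⟩` says that its term at 0 is `true`, whose code is 1; backwards, the index `m` itself
  -- realizes membership.
  obtain ⟨s, hs, hs'⟩ := exists_parametrization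
    (g := fun q => Nat.pair (constIdx (Encodable.encode (d q)))
      (Nat.pair (constIdx (Nat.pair 0 1)) (constIdx q.unpair.2)))
    (computable_mk (computable_constIdx.comp (Computable.encode.comp hd))
      (computable_mk (Computable.const _) (computable_constIdx.comp computable_snd)))
  obtain ⟨e, he⟩ := exists_index_total
    (f := fun n => Nat.pair (Nat.pair (Nat.pair p p) (Nat.pair a a)) (Nat.pair (s n) (s n)))
    (computable_mk (Computable.const _) (computable_mk hs hs))
  refine ⟨e, Set.mem_iInter.2 fun n k hk => ⟨_, he k, ?_⟩⟩
  obtain rfl := mem_nat_eq.1 hk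
  have ha' : a ∈ ⋂ x, imp (X.family S k x) (X.family S k x) :=
    Set.mem_iInter.2 fun x m hm => ⟨_, ha m, hm⟩
  have hs'' : s k ∈ all X.toObj fun x => semidecidable (X.family S k x) := by
    refine Set.mem_iInter.2 fun x m hm => ⟨_, hs' k m ▸ Part.mem_some _, ?_⟩
    refine Set.mem_iUnion.2 ⟨fun _ => d (Nat.pair k m), pair_mem_and.2 ⟨?_, pair_mem_and.2 ⟨?_, ?_⟩⟩⟩
    · exact Set.mem_iInter.2 fun i => constIdx_mem_imp ⟨rfl, rfl⟩
    · intro l hl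
      have hdt := (h k m x hm.1).2 hl.2
      exact constIdx_mem_imp (Set.mem_iUnion.2 ⟨(0 : ℕ), pair_mem_and.2
        ⟨mem_nat_eq.2 rfl, mem_disc_eq.2 (by simp [hdt])⟩⟩) l hl
    · intro l hl
      obtain ⟨i, -, -, hdt⟩ := Set.mem_iUnion.1 hl
      refine constIdx_mem_imp ?_ l hl
      simpa using ⟨hm.1, (h k m x hm.1).1 hdt⟩
  exact pair_mem_and.2 ⟨pair_mem_and.2 ⟨pair_mem_and.2 ⟨hp k, hp k⟩, pair_mem_and.2 ⟨ha', ha'⟩⟩,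
    pair_mem_and.2 ⟨hs'', hs''⟩⟩

variable {X S}

/-- A family covers when a member containing a point is computable from an index of the point. -/
theorem valid_covers {c : ℕ → ℕ} (hc : Computable c) (h : ∀ m x, x ∈ X.ν m → x ∈ S (c m)) :
    Valid (covers X.toObj (X.family S)) := by
  obtain ⟨e, he⟩ := exists_index_total (computable_mk hc Computable.id)
  exact ⟨e, Set.mem_iInter.2 fun x m hm => ⟨_, he m, Set.mem_iUnion.2 ⟨c m,
    pair_mem_and.2 ⟨mem_nat_eq.2 rfl, hm.1, h m x hm.1⟩⟩⟩⟩

/-- A family is a pointwise base when it contains the singleton of every point, computably in an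
index of the point. -/
theorem valid_pointwiseBase {c : ℕ → ℕ} (hc : Computable c)
    (h : ∀ m x, x ∈ X.ν m → S (c m) = {x}) :
    Valid (pointwiseBase X.toObj (X.family S)) := by
  obtain ⟨d, hd⟩ := exists_index_total (computable_mk Computable.id Computable.id)
  -- The first half of a realizer `r` of `x ∈ B i ∩ B j` is already an index of `x`, so `i`, `j` and
  -- the separately given index can be ignored. Inside the singleton, `d` duplicates an index to
  -- realize both memberships.
  obtain ⟨e, he⟩ := exists_index_total (f := fun r => Nat.pair (c r.unpair.1)
      (Nat.pair r.unpair.1 (constIdx d)))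
    (computable_mk (hc.comp computable_fst) (computable_mk computable_fst (Computable.const _)))
  refine ⟨constIdx (constIdx (constIdx e)), Set.mem_iInter.2 fun i => constIdx_mem_imp
    (Set.mem_iInter.2 fun j => constIdx_mem_imp (Set.mem_iInter.2 fun x => constIdx_mem_imp ?_))⟩
  rintro r ⟨hi, hj⟩
  have hS := h _ x hi.1
  refine ⟨_, he r, Set.mem_iUnion.2 ⟨c r.unpair.1, pair_mem_and.2 ⟨mem_nat_eq.2 rfl,
    pair_mem_and.2 ⟨⟨hi.1, hS ▸ rfl⟩, Set.mem_iInter.2 fun y => constIdx_mem_imp ?_⟩⟩⟩⟩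
  rintro l ⟨hl, hy⟩
  obtain rfl : y = x := by rwa [hS] at hy
  exact ⟨_, hd l, pair_mem_and.2 ⟨⟨hl, hi.2⟩, ⟨hl, hj.2⟩⟩⟩

end NumberedSet

/-! ### The numbering by membership bits -/

theorem mem_bitNumbering {U V X : Set ℕ} {m : ℕ} {x : (bitNumbering U V X).Carrier}
    (h : x ∈ (bitNumbering U V X).ν m) :
    x.1 = m / 4 ∧ (m % 2 = 1 ↔ x.1 ∈ U) ∧ (m / 2 % 2 = 1 ↔ x.1 ∈ V) := by
  obtain ⟨h, rfl⟩ := h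
  exact ⟨rfl, h.2⟩

/-- The bit numbering gives a pointwise base that is not a countable base, when neither of `U`, `V`
contains the other and `U ∩ V` is not the trace on `X` of a c.e. set. -/
theorem isPointwiseNotCountableBase_bitNumbering {U V X : Set ℕ} (hUV : ((U \ V) ∩ X).Nonempty)
    (hVU : ((V \ U) ∩ X).Nonempty) (hK : ∀ K : Set ℕ, REPred (· ∈ K) → K ∩ X ≠ U ∩ V ∩ X) :
    IsPointwiseNotCountableBase (bitNumbering U V X).toObj
      ((bitNumbering U V X).family (bitSets U V X)) := by
  -- The shift by 2 skips `U` and `V`: the singleton of `m / 4` stands at place `m / 4 + 2`.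
  have half : Computable fun m : ℕ => m / 4 + 2 :=
    (Primrec.nat_add.comp (Primrec.nat_div.comp Primrec.id (Primrec.const 4))
      (Primrec.const 2)).to_comp
  have hB : Valid ((seq (opens (bitNumbering U V X).toObj)).eq
      ((bitNumbering U V X).family (bitSets U V X))
      ((bitNumbering U V X).family (bitSets U V X))) := by
    have hf : Primrec fun q : ℕ => q.unpair.1 := Primrec.fst.comp Primrec.unpair
    have hs : Primrec fun q : ℕ => q.unpair.2 := Primrec.snd.comp Primrec.unpair
    refine NumberedSet.valid_seq_opens_eq _ _
      (d := fun q => bif decide (q.unpair.1 = 0) then decide (q.unpair.2 % 2 = 1) else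
        bif decide (q.unpair.1 = 1) then decide (q.unpair.2 / 2 % 2 = 1) else
        decide (q.unpair.1 = q.unpair.2 / 4 + 2)) ?_ ?_
    · exact (Primrec.cond (Primrec.eq.decide.comp hf (Primrec.const 0))
        (Primrec.eq.decide.comp (Primrec.nat_mod.comp hs (Primrec.const 2)) (Primrec.const 1))
        (Primrec.cond (Primrec.eq.decide.comp hf (Primrec.const 1))
          (Primrec.eq.decide.comp (Primrec.nat_mod.comp
            (Primrec.nat_div.comp hs (Primrec.const 2)) (Primrec.const 2)) (Primrec.const 1))
          (Primrec.eq.decide.comp hf (Primrec.nat_add.comp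
            (Primrec.nat_div.comp hs (Primrec.const 4)) (Primrec.const 2))))).to_comp
    · intro n m x hx
      obtain ⟨h0, h1, h2⟩ := mem_bitNumbering hx
      match n with
      | 0 =>
        have h3 : x ∈ bitSets U V X 0 ↔ m % 2 = 1 := h1.symm
        simp [h3]
      | 1 =>
        have h3 : x ∈ bitSets U V X 1 ↔ m / 2 % 2 = 1 := h2.symm
        simp [h3]
      | n + 2 =>
        have h3 : x ∈ bitSets U V X (n + 2) ↔ n = m / 4 := h0 ▸ eq_comm
        simp [h3]
  refine ⟨hB, NumberedSet.valid_covers half fun m x hx => (mem_bitNumbering hx).1,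
    NumberedSet.valid_pointwiseBase half fun m x hx => ?_, valid_neg fun h => ?_⟩
  · ext y
    have h := (mem_bitNumbering hx).1
    exact ⟨fun hy => Subtype.ext (Eq.trans hy h.symm), by rintro rfl; exact h⟩
  · obtain ⟨I, hI, h⟩ := exists_rePred_of_countableBase hB h 0 1
    have key : ∀ x : X, (x.1 ∈ U ∧ x.1 ∈ V) ↔ ∃ k ∈ I, x ∈ bitSets U V X k := fun x => by
      have fam : ∀ n, Valid ((bitNumbering U V X).family (bitSets U V X) n x) ↔
          x ∈ bitSets U V X n := fun n => NumberedSet.valid_family _ _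
      refine (and_congr (fam 0) (fam 1)).symm.trans
        ((h x (NumberedSet.valid_eq (bitNumbering U V X) x)).trans ?_)
      exact exists_congr fun k => and_congr_right fun _ => fam k
    obtain ⟨u, ⟨huU, huV⟩, huX⟩ := hUV
    obtain ⟨v, ⟨hvV, hvU⟩, hvX⟩ := hVU
    -- If 0 were in `I`, then `U` would be part of the union, so `u` would lie in `V`; symmetrically
    -- for 1.
    have h0 : 0 ∉ I := fun h => huV ((key ⟨u, huX⟩).2 ⟨0, h, huU⟩).2
    have h1 : 1 ∉ I := fun h => hvU ((key ⟨v, hvX⟩).2 ⟨1, h, hvV⟩).1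
    refine hK {n | n + 2 ∈ I} (hI.comp_computable (f := fun n : ℕ => n + 2)
      (Primrec.succ.comp Primrec.succ).to_comp) ?_
    ext n
    refine and_congr_left fun hn => Iff.trans ?_ (key ⟨n, hn⟩).symm
    constructor
    · exact fun h => ⟨n + 2, h, rfl⟩
    · rintro ⟨k, hk, h⟩
      match k with
      | 0 => exact absurd hk h0
      | 1 => exact absurd hk h1
      | k + 2 =>
        obtain rfl : n = k := h
        exact hk

/-- No maximal set is needed: `U` and `V` share a copy of a non-c.e. set `A` shifted by 2, and the
points 0 and 1 make them incomparable. With `X = ℕ`, a trace on `X` is the set itself. -/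
theorem exists_isPointwiseNotCountableBase : ∃ (X : NumberedSet) (S : ℕ → Set X.Carrier),
    IsPointwiseNotCountableBase X.toObj (X.family S) := by
  obtain ⟨A, hA⟩ := exists_not_rePred
  refine ⟨bitNumbering {n | n = 0 ∨ 2 ≤ n ∧ n - 2 ∈ A} {n | n = 1 ∨ 2 ≤ n ∧ n - 2 ∈ A} Set.univ,
    bitSets _ _ _, isPointwiseNotCountableBase_bitNumbering ⟨0, by simp⟩ ⟨1, by simp⟩
      fun K hK h => hA ?_⟩
  refine (hK.comp_computable (f := fun n : ℕ => n + 2)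
    (Primrec.succ.comp Primrec.succ).to_comp).of_eq fun n => ?_
  simpa using Set.ext_iff.1 h (n + 2)

theorem IsConfiguration.isPointwiseNotCountableBase {M U V X : Set ℕ} (hM : IsMaximalCE M)
    (h : IsConfiguration M U V X) :
    IsPointwiseNotCountableBase (bitNumbering U V X).toObj
      ((bitNumbering U V X).family (bitSets U V X)) := by
  have hU : U ⊆ X := Set.subset_union_left.trans h.union_subset
  have hV : V ⊆ X := Set.subset_union_right.trans h.union_subset
  obtain ⟨u, hu, hu'⟩ := h.left_diff.nonempty
  obtain ⟨v, hv, hv'⟩ := h.right_diff.nonempty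
  refine isPointwiseNotCountableBase_bitNumbering ⟨u, ⟨hu, fun h => hu' ⟨hu, h⟩⟩, hU hu⟩
    ⟨v, ⟨hv, fun h => hv' ⟨h, hv⟩⟩, hV hv⟩ fun K hK hKX => ?_
  rw [Set.inter_eq_left.2 (Set.inter_subset_left.trans hU)] at hKX
  have hMK : M ⊆ K := fun n hn => (hKX.symm ▸ h.subset_inter hn : n ∈ K ∩ X).1
  obtain hf | hf := hM.maximal K hK hMK
  -- Here `U ∩ V ⊆ K`, so `U ∩ V` is `M` together with a finite set.
  · refine h.inter_not_ce ?_
    have hfin : ((U ∩ V) \ M).Finite :=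
      hf.subset (Set.sdiff_subset_sdiff_left (hKX ▸ Set.inter_subset_left))
    have := hM.ce.union_finite hfin
    rwa [Set.union_sdiff_cancel h.subset_inter] at this
  -- A point of `U` in `K` lies in `K ∩ X = U ∩ V`, so `U \ (U ∩ V)` is contained in the finite
  -- complement of `K`.
  · refine h.left_diff (hf.subset fun n hn hnK => hn.2 ?_)
    rw [← hKX]
    exact ⟨hnK, hU hn.1⟩

end Eff

theorem mainTheorem4 :
    (∃ (X : Eff.NumberedSet) (S : ℕ → Set X.Carrier),
      Eff.IsPointwiseNotCountableBase X.toObj (X.family S)) ∧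
    (∀ M : Set ℕ, Eff.IsMaximalCE M →
      (∃ U V X : Set ℕ, Eff.IsConfiguration M U V X) ∧
      (∀ U V X : Set ℕ, Eff.IsConfiguration M U V X →
        Eff.IsPointwiseNotCountableBase (Eff.bitNumbering U V X).toObj
          ((Eff.bitNumbering U V X).family (Eff.bitSets U V X)))) :=
  ⟨Eff.exists_isPointwiseNotCountableBase, fun _ hM => ⟨hM.exists_isConfiguration,
    fun _ _ _ h => h.isPointwiseNotCountableBase hM⟩⟩
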